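/- Let $K$ be a compact Hausdorff space that is zero-dimensional (the clopen subsets of $K$ form a basis of its topology) and whose isolated points are dense in $K$. Let $C(K)$ be the Banach space of all real-valued continuous functions on $K$ with the supremum norm, and let $B_{C(K)}$ be its closed unit ball, with the metric induced by the norm. Then every homeomorphism $F$ of $B_{C(K)}$ onto itself that is non-expansive, i.e. $\|F(f)-F(g)\|\le\|f-g\|$ for all $f,g\in B_{C(K)}$, is an isometry, i.e. $\|F(f)-F(g)\|=\|f-g\|$ for all $f,g\in B_{C(K)}$. -/

import Mathlib

/-- A topological space is zero-dimensional if its clopen subsets form a basis of its topology. -/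
def IsZeroDimensional (K : Type*) [TopologicalSpace K] : Prop :=
  TopologicalSpace.IsTopologicalBasis {s : Set K | IsClopen s}

/-- A point of a topological space is isolated if its singleton is open. -/
def IsIsolatedPoint {K : Type*} [TopologicalSpace K] (x : K) : Prop :=
  IsOpen ({x} : Set K)

/-! Let `φ` be the map and `γ` its inverse. The point is that `φ` is a weighted composition: `φ g a
= γ 1 b * g b` for matched isolated points `a`, `b`, with weights `±1` (`map_apply`). Density of the
isolated points then gives the isometry.

The matching comes from the functions `y` with values `±1`. Non-expansiveness forces `φ (t • γ y) =
t • y` for `0 ≤ t ≤ 1`, and eventually sends the orthant of `γ y` into that of `y`. Injectivity,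
tested on functions supported at one isolated point, shows that `γ y` again has values `±1` and that
flipping one sign of `y` flips exactly one sign of `γ y` (`exists_inv_flipAt`), at a place
independent of `y` (`exists_corresponds`).

A connectedness argument shows that `γ` respects orthants; hence, at matched points, it keeps signs
up to the weight, keeps zeros and does not decrease moduli (`compare`). The reverse inequality is a
bootstrap: if `φ` does not lower moduli below a level `r`, it is the weighted composition on
functions whose values are unimodular or smaller than `r`. These lie close enough to any `g` to
raise the level, which tends to `1` (`raise_level`, `min_abs_le`). -/

open Set Filter Topology

/-! ### Clopen gluing, spikes and unimodular functions -/

section BallMaps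

variable {K : Type*} [TopologicalSpace K]

open Classical in
/-- The continuous function equal to `f` on the clopen set `V` and to `g` off `V`. -/
noncomputable def clopenPiecewise {V : Set K} (hV : IsClopen V) (f g : C(K, ℝ)) : C(K, ℝ) where
  toFun := V.piecewise f g
  continuous_toFun := Continuous.piecewise (by simp [hV.frontier_eq]) f.continuous g.continuous

theorem clopenPiecewise_of_mem {V : Set K} (hV : IsClopen V) (f g : C(K, ℝ)) {k : K}
    (hk : k ∈ V) : clopenPiecewise hV f g k = f k := by
  classical exact Set.piecewise_eq_of_mem _ _ _ hk

theorem clopenPiecewise_of_notMem {V : Set K} (hV : IsClopen V) (f g : C(K, ℝ)) {k : K}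
    (hk : k ∉ V) : clopenPiecewise hV f g k = g k := by
  classical exact Set.piecewise_eq_of_notMem _ _ _ hk

theorem IsIsolatedPoint.isClopen [T2Space K] {a : K} (ha : IsIsolatedPoint a) :
    IsClopen ({a} : Set K) := ⟨isClosed_singleton, ha⟩

/-- In a compact zero-dimensional space a clopen set separates two levels of a function. -/
theorem IsZeroDimensional.exists_isClopen_levels [CompactSpace K] [T2Space K]
    (hK : IsZeroDimensional K) (f : C(K, ℝ)) {s t : ℝ} (hst : s < t) :
    ∃ V : Set K, IsClopen V ∧ (∀ k, t ≤ f k → k ∈ V) ∧ ∀ k ∈ V, s < f k := by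
  have hZ : IsClosed {k | t ≤ f k} := isClosed_le continuous_const f.continuous
  have hU : IsOpen {k | s < f k} := isOpen_lt continuous_const f.continuous
  have : ∃ V : Set K, IsClopen V ∧ {k | t ≤ f k} ⊆ V ∧ V ⊆ {k | s < f k} := by
    refine hZ.isCompact.induction_on (p := fun Z => ∃ V : Set K, IsClopen V ∧ Z ⊆ V ∧
      V ⊆ {k | s < f k}) ⟨∅, isClopen_empty, by simp, by simp⟩ ?_ ?_ ?_
    · rintro A B hAB ⟨V, h1, h2, h3⟩
      exact ⟨V, h1, hAB.trans h2, h3⟩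
    · rintro A B ⟨V, h1, h2, h3⟩ ⟨W, h4, h5, h6⟩
      exact ⟨V ∪ W, h1.union h4, union_subset_union h2 h5, union_subset h3 h6⟩
    · intro x hx
      obtain ⟨V, hV, hxV, hVU⟩ := hK.exists_subset_of_mem_open
        (show x ∈ {k | s < f k} from lt_of_lt_of_le hst hx) hU
      exact ⟨V, mem_nhdsWithin_of_mem_nhds (hV.2.mem_nhds hxV), V, hV, Subset.rfl, hVU⟩
  obtain ⟨V, hV, h1, h2⟩ := this
  exact ⟨V, hV, fun k hk => h1 hk, fun k hk => h2 hk⟩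

/-- The flip of the sign of `y` at the isolated point `a`. -/
noncomputable def flipAt [T2Space K] {a : K} (ha : IsIsolatedPoint a) (y : C(K, ℝ)) : C(K, ℝ) :=
  clopenPiecewise ha.isClopen (-y) y

theorem flipAt_self [T2Space K] {a : K} (ha : IsIsolatedPoint a) (y : C(K, ℝ)) :
    flipAt ha y a = -y a := clopenPiecewise_of_mem _ _ _ rfl

theorem flipAt_of_ne [T2Space K] {a k : K} (ha : IsIsolatedPoint a) (y : C(K, ℝ)) (hk : k ≠ a) :
    flipAt ha y k = y k := clopenPiecewise_of_notMem _ _ _ hk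

/-- The function equal to `t` at the isolated point `a` and to zero elsewhere. -/
noncomputable def spike [T2Space K] {a : K} (ha : IsIsolatedPoint a) (t : ℝ) : C(K, ℝ) :=
  clopenPiecewise ha.isClopen (ContinuousMap.const K t) 0

theorem spike_self [T2Space K] {a : K} (ha : IsIsolatedPoint a) (t : ℝ) : spike ha t a = t :=
  clopenPiecewise_of_mem _ _ _ rfl

theorem spike_of_ne [T2Space K] {a k : K} (ha : IsIsolatedPoint a) (t : ℝ) (hk : k ≠ a) :
    spike ha t k = 0 := clopenPiecewise_of_notMem _ _ _ hk

theorem abs_spike_le [T2Space K] {a : K} (ha : IsIsolatedPoint a) {t c : ℝ} (ht : |t| ≤ c)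
    (k : K) : |spike ha t k| ≤ c := by
  by_cases h : k = a
  · subst h; rwa [spike_self]
  · rw [spike_of_ne ha t h, abs_zero]; exact (abs_nonneg t).trans ht

/-- A function with values in `{1, -1}`. -/
def IsUnimodular (y : C(K, ℝ)) : Prop := ∀ k, y k = 1 ∨ y k = -1

theorem IsUnimodular.abs_le {y : C(K, ℝ)} (hy : IsUnimodular y) (k : K) : |y k| ≤ 1 := by
  rcases hy k with h | h <;> simp [h]

theorem IsUnimodular.neg {y : C(K, ℝ)} (hy : IsUnimodular y) : IsUnimodular (-y) := by
  intro k
  rcases hy k with h | h <;> simp [h]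

theorem IsUnimodular.flipAt [T2Space K] {a : K} (ha : IsIsolatedPoint a) {y : C(K, ℝ)}
    (hy : IsUnimodular y) : IsUnimodular (flipAt ha y) := by
  intro k
  by_cases h : k = a
  · subst h; rw [flipAt_self]; rcases hy k with h | h <;> simp [h]
  · rw [flipAt_of_ne ha y h]; exact hy k

theorem IsUnimodular.one : IsUnimodular (1 : C(K, ℝ)) := fun _ => Or.inl rfl

/-- `φ` is a non-expansive self-bijection of the unit ball of `C(K, ℝ)` with continuous
inverse `γ`. -/
structure IsNonexpansiveBallHomeo (φ γ : C(K, ℝ) → C(K, ℝ)) : Prop where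
  abs_map_le : ∀ g : C(K, ℝ), (∀ k, |g k| ≤ 1) → ∀ k, |φ g k| ≤ 1
  abs_inv_le : ∀ f : C(K, ℝ), (∀ k, |f k| ≤ 1) → ∀ k, |γ f k| ≤ 1
  left_inv : ∀ g : C(K, ℝ), (∀ k, |g k| ≤ 1) → γ (φ g) = g
  right_inv : ∀ f : C(K, ℝ), (∀ k, |f k| ≤ 1) → φ (γ f) = f
  nonexpansive : ∀ g h : C(K, ℝ), (∀ k, |g k| ≤ 1) → (∀ k, |h k| ≤ 1) → ∀ c : ℝ, 0 ≤ c →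
    (∀ k, |g k - h k| ≤ c) → ∀ k, |φ g k - φ h k| ≤ c
  continuousOn_inv : ContinuousOn γ {f | ∀ k, |f k| ≤ 1}

/-- Functions that agree on the isolated points agree. -/
theorem ContinuousMap.eq_of_isolated (hiso : Dense {x : K | IsIsolatedPoint x}) {f g : C(K, ℝ)}
    (h : ∀ a, IsIsolatedPoint a → f a = g a) : f = g :=
  ContinuousMap.ext fun k => congrFun
    (Continuous.ext_on hiso f.continuous g.continuous fun a ha => h a ha) k

/-- A pointwise closed condition that holds at the isolated points holds everywhere. -/
theorem forall_of_isolated (hiso : Dense {x : K | IsIsolatedPoint x}) {p : K → Prop}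
    (hp : IsClosed {k | p k}) (h : ∀ a, IsIsolatedPoint a → p a) (k : K) : p k := by
  have : closure {x : K | IsIsolatedPoint x} ⊆ {k | p k} := closure_minimal h hp
  exact this (hiso k)

end BallMaps

/-! ### Unimodular functions and their orthants -/

namespace IsNonexpansiveBallHomeo

variable {K : Type*} [TopologicalSpace K] {φ γ : C(K, ℝ) → C(K, ℝ)}

/-- Every point of the ball is the image of a point within `1` of zero, hence lies within `1` of `φ
0`; the constants `1` and `-1` leave only zero. -/
theorem map_zero (H : IsNonexpansiveBallHomeo φ γ) : φ 0 = 0 := by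
  have h0 : ∀ k : K, |(0 : C(K, ℝ)) k| ≤ 1 := by simp
  have key : ∀ y : C(K, ℝ), (∀ k, |y k| ≤ 1) → ∀ k, |y k - φ 0 k| ≤ 1 := by
    intro y hy k
    have := H.nonexpansive (γ y) 0 (H.abs_inv_le y hy) h0 1 zero_le_one
      (by simpa using H.abs_inv_le y hy) k
    rwa [H.right_inv y hy] at this
  ext k
  have h1 := key 1 (by simp) k
  have h2 := key (-1) (by simp) k
  simp only [ContinuousMap.one_apply, ContinuousMap.neg_apply, ContinuousMap.zero_apply] at *
  rw [abs_le] at h1 h2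
  linarith

theorem injective (H : IsNonexpansiveBallHomeo φ γ) {g h : C(K, ℝ)} (hg : ∀ k, |g k| ≤ 1)
    (hh : ∀ k, |h k| ≤ 1) (e : φ g = φ h) : g = h := by
  rw [← H.left_inv g hg, e, H.left_inv h hh]

theorem inv_injective (H : IsNonexpansiveBallHomeo φ γ) {g h : C(K, ℝ)} (hg : ∀ k, |g k| ≤ 1)
    (hh : ∀ k, |h k| ≤ 1) (e : γ g = γ h) : g = h := by
  rw [← H.right_inv g hg, e, H.right_inv h hh]

theorem abs_smul_le {t : ℝ} (ht0 : 0 ≤ t) {g : C(K, ℝ)} (hg : ∀ k, |g k| ≤ 1)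
    (k : K) : |(t • g) k| ≤ t := by
  rw [ContinuousMap.smul_apply, smul_eq_mul, abs_mul, abs_of_nonneg ht0]
  nlinarith [hg k]

/-- At each point the value is within `t` of `0` and within `1 - t` of `y k = ±1`; these two
intervals meet only at `t * y k`. -/
theorem map_smul_inv (H : IsNonexpansiveBallHomeo φ γ) {y : C(K, ℝ)} (hy : IsUnimodular y)
    {t : ℝ} (ht0 : 0 ≤ t) (ht1 : t ≤ 1) : φ (t • γ y) = t • y := by
  have hx := H.abs_inv_le y hy.abs_le
  have htx : ∀ k, |(t • γ y) k| ≤ 1 := fun k => (abs_smul_le ht0 hx k).trans ht1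
  ext k
  have h1 := H.nonexpansive (t • γ y) 0 htx (by simp) t ht0
    (by simpa using abs_smul_le ht0 hx) k
  have h2 := H.nonexpansive (t • γ y) (γ y) htx hx (1 - t) (by linarith) (fun k => by
    have : (t • γ y) k - γ y k = -(((1 - t) • γ y) k) := by
      simp only [ContinuousMap.smul_apply, smul_eq_mul]; ring
    rw [this, abs_neg]
    exact abs_smul_le (by linarith) hx k) k
  rw [H.map_zero] at h1
  rw [H.right_inv y hy.abs_le] at h2
  simp only [ContinuousMap.zero_apply, sub_zero, ContinuousMap.smul_apply, smul_eq_mul] at *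
  rw [abs_le] at h1 h2
  rcases hy k with h | h <;> rw [h] at h2 ⊢ <;> linarith

/-- The half-radius ball around `γ y / 2` is mapped into the orthant of `y`. -/
theorem mul_map_nonneg_of_abs_sub_le (H : IsNonexpansiveBallHomeo φ γ) {y : C(K, ℝ)}
    (hy : IsUnimodular y) {g : C(K, ℝ)} (hg : ∀ k, |g k| ≤ 1)
    (h : ∀ k, |g k - γ y k / 2| ≤ 1 / 2) (k : K) : 0 ≤ y k * φ g k := by
  have hx := H.abs_inv_le y hy.abs_le
  have := H.nonexpansive g ((1 / 2 : ℝ) • γ y) hg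
    (fun k => (abs_smul_le (by norm_num) hx k).trans (by norm_num)) (1 / 2)
    (by norm_num) (fun k => by
      simpa only [ContinuousMap.smul_apply, smul_eq_mul, one_div, inv_mul_eq_div] using h k) k
  rw [H.map_smul_inv hy (by norm_num) (by norm_num)] at this
  simp only [ContinuousMap.smul_apply, smul_eq_mul] at this
  rw [abs_le] at this
  rcases hy k with h | h <;> rw [h] at this ⊢ <;> linarith

/-- Antipodality of two reals is detected by the intersection of two half-radius intervals. -/
theorem antipodal_of_forall {p q : ℝ} (hp : |p| ≤ 1) (hq : |q| ≤ 1)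
    (h : ∀ t : ℝ, |t| ≤ 1 → |t - p / 2| ≤ 1 / 2 → |t - q / 2| ≤ 1 / 2 → t = 0) :
    (p = 1 ∧ q = -1) ∨ (p = -1 ∧ q = 1) := by
  rw [abs_le] at hp hq
  -- The smaller right endpoint and the larger left endpoint both lie in the intersection of the
  -- intervals, so both must vanish.
  have h1 := h (min ((p + 1) / 2) ((q + 1) / 2))
  have h2 := h (max ((p - 1) / 2) ((q - 1) / 2))
  simp only [abs_le] at h1 h2
  rcases le_total p q with hpq | hpq
  · rw [min_eq_left (by linarith)] at h1
    rw [max_eq_right (by linarith)] at h2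
    have := h1 ⟨by linarith, by linarith⟩ ⟨by linarith, by linarith⟩ ⟨by linarith, by linarith⟩
    have := h2 ⟨by linarith, by linarith⟩ ⟨by linarith, by linarith⟩ ⟨by linarith, by linarith⟩
    right; constructor <;> linarith
  · rw [min_eq_right (by linarith)] at h1
    rw [max_eq_left (by linarith)] at h2
    have := h1 ⟨by linarith, by linarith⟩ ⟨by linarith, by linarith⟩ ⟨by linarith, by linarith⟩
    have := h2 ⟨by linarith, by linarith⟩ ⟨by linarith, by linarith⟩ ⟨by linarith, by linarith⟩
    left; constructor <;> linarith

variable [T2Space K]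

/-- Otherwise, at some isolated point, a nonzero spike lies in the half-radius balls around both `γ
y / 2` and `γ (-y) / 2`. Its image is then in two opposite orthants, hence zero, against
injectivity. -/
theorem inv_antipodal (H : IsNonexpansiveBallHomeo φ γ)
    (hiso : Dense {x : K | IsIsolatedPoint x}) {y : C(K, ℝ)} (hy : IsUnimodular y) (k : K) :
    (γ y k = 1 ∧ γ (-y) k = -1) ∨ (γ y k = -1 ∧ γ (-y) k = 1) := by
  have hx := H.abs_inv_le y hy.abs_le
  have hz := H.abs_inv_le (-y) hy.neg.abs_le
  have hcl : IsClosed {k | (γ y k = 1 ∧ γ (-y) k = -1) ∨ (γ y k = -1 ∧ γ (-y) k = 1)} := by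
    have c1 := (γ y).continuous
    have c2 := (γ (-y)).continuous
    exact ((isClosed_eq c1 continuous_const).inter (isClosed_eq c2 continuous_const)).union
      ((isClosed_eq c1 continuous_const).inter (isClosed_eq c2 continuous_const))
  refine forall_of_isolated hiso hcl (fun a ha => ?_) k
  refine antipodal_of_forall (hx a) (hz a) fun t ht h1 h2 => ?_
  have hb := abs_spike_le ha ht
  have near : ∀ x : C(K, ℝ), (∀ k, |x k| ≤ 1) → |t - x a / 2| ≤ 1 / 2 →
      ∀ k, |spike ha t k - x k / 2| ≤ 1 / 2 := by
    intro x hx h k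
    by_cases hk : k = a
    · subst hk; rwa [spike_self]
    · rw [spike_of_ne ha t hk, zero_sub, abs_neg, abs_div, abs_two]
      linarith [hx k]
  have e : φ (spike ha t) = φ 0 := by
    rw [H.map_zero]
    ext k
    have p1 := H.mul_map_nonneg_of_abs_sub_le hy hb (near _ hx h1) k
    have p2 := H.mul_map_nonneg_of_abs_sub_le hy.neg hb (near _ hz h2) k
    simp only [ContinuousMap.neg_apply, ContinuousMap.zero_apply] at *
    rcases hy k with h | h <;> rw [h] at p1 p2 <;> linarith
  have := congrArg (fun f : C(K, ℝ) => f a) (H.injective hb (by simp) e)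
  simpa [spike_self] using this

theorem inv_unimodular (H : IsNonexpansiveBallHomeo φ γ)
    (hiso : Dense {x : K | IsIsolatedPoint x}) {y : C(K, ℝ)} (hy : IsUnimodular y) :
    IsUnimodular (γ y) := fun k => (H.inv_antipodal hiso hy k).imp And.left And.left

theorem inv_neg (H : IsNonexpansiveBallHomeo φ γ)
    (hiso : Dense {x : K | IsIsolatedPoint x}) {y : C(K, ℝ)} (hy : IsUnimodular y) :
    γ (-y) = -γ y := by
  ext k
  rw [ContinuousMap.neg_apply]
  rcases H.inv_antipodal hiso hy k with ⟨h1, h2⟩ | ⟨h1, h2⟩ <;> rw [h1, h2]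
  norm_num

/-- The orthant of `γ y` is mapped into the orthant of `y`. -/
theorem mul_map_nonneg (H : IsNonexpansiveBallHomeo φ γ)
    (hiso : Dense {x : K | IsIsolatedPoint x}) {y : C(K, ℝ)} (hy : IsUnimodular y)
    {g : C(K, ℝ)} (hg : ∀ k, |g k| ≤ 1) (h : ∀ k, 0 ≤ γ y k * g k) (k : K) :
    0 ≤ y k * φ g k := by
  refine H.mul_map_nonneg_of_abs_sub_le hy hg (fun k => ?_) k
  have h1 := h k
  have h2 := abs_le.1 (hg k)
  rw [abs_le]
  rcases H.inv_unimodular hiso hy k with h | h <;> rw [h] at h1 ⊢ <;> constructor <;> linarith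

theorem mul_map_nonpos (H : IsNonexpansiveBallHomeo φ γ)
    (hiso : Dense {x : K | IsIsolatedPoint x}) {y : C(K, ℝ)} (hy : IsUnimodular y)
    {g : C(K, ℝ)} (hg : ∀ k, |g k| ≤ 1) (h : ∀ k, γ y k * g k ≤ 0) (k : K) :
    y k * φ g k ≤ 0 := by
  have := H.mul_map_nonneg hiso hy.neg hg (fun k => by
    rw [H.inv_neg hiso hy, ContinuousMap.neg_apply, neg_mul]; linarith [h k]) k
  rw [ContinuousMap.neg_apply, neg_mul] at this
  linarith

/-- A function in the orthants of `γ y` and of `-γ (flipAt a y)` is mapped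
to a function supported at `a`. -/
theorem map_eq_zero_of_opposite (H : IsNonexpansiveBallHomeo φ γ)
    (hiso : Dense {x : K | IsIsolatedPoint x}) {y : C(K, ℝ)} (hy : IsUnimodular y) {a : K}
    (ha : IsIsolatedPoint a) {g : C(K, ℝ)} (hg : ∀ k, |g k| ≤ 1) (h : ∀ k, 0 ≤ γ y k * g k)
    (h' : ∀ k, γ (flipAt ha y) k * g k ≤ 0) {k : K} (hk : k ≠ a) : φ g k = 0 := by
  have p1 := H.mul_map_nonneg hiso hy hg h k
  have p2 := H.mul_map_nonpos hiso (hy.flipAt ha) hg h' k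
  rw [flipAt_of_ne ha y hk] at p2
  rcases hy k with h | h <;> rw [h] at p1 p2 <;> linarith

/-! ### Sign flips at isolated points -/

omit [T2Space K] in
/-- Two arcs issuing from zero in a half-line meet again. -/
theorem exists_common_value {p q : ℝ → ℝ} (hp : ContinuousOn p (Icc 0 1))
    (hq : ContinuousOn q (Icc 0 1)) (hp0 : p 0 = 0) (hq0 : q 0 = 0) (hp1 : 0 < p 1)
    (hq1 : 0 < q 1) : ∃ s ∈ Icc (0 : ℝ) 1, ∃ t ∈ Icc (0 : ℝ) 1, s ≠ 0 ∧ p s = q t := by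
  rcases le_total (p 1) (q 1) with h | h
  · obtain ⟨t, ht, e⟩ := intermediate_value_Icc zero_le_one hq
      (show p 1 ∈ Icc (q 0) (q 1) from ⟨by linarith, h⟩)
    exact ⟨1, by simp, t, ht, one_ne_zero, e.symm⟩
  · obtain ⟨s, hs, e⟩ := intermediate_value_Icc zero_le_one hp
      (show q 1 ∈ Icc (p 0) (p 1) from ⟨by linarith, h⟩)
    refine ⟨s, hs, 1, by simp, ?_, e⟩
    rintro rfl
    linarith

theorem continuousOn_map_spike (H : IsNonexpansiveBallHomeo φ γ) {b : K}
    (hb : IsIsolatedPoint b) (x : ℝ) (hx : |x| ≤ 1) (a : K) :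
    ContinuousOn (fun t => φ (spike hb (x * t)) a) (Icc 0 1) := by
  have hball : ∀ t ∈ Icc (0 : ℝ) 1, ∀ k, |spike hb (x * t) k| ≤ 1 := fun t ht =>
    abs_spike_le hb (by rw [abs_mul, abs_of_nonneg ht.1]; nlinarith [ht.1, ht.2, abs_nonneg x])
  refine LipschitzOnWith.continuousOn (K := 1) (LipschitzOnWith.of_dist_le_mul ?_)
  intro s hs t ht
  rw [NNReal.coe_one, one_mul, Real.dist_eq]
  refine H.nonexpansive _ _ (hball s hs) (hball t ht) _ dist_nonneg (fun k => ?_) a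
  rw [Real.dist_eq]
  by_cases hk : k = b
  · subst hk
    rw [spike_self, spike_self, ← mul_sub, abs_mul]
    nlinarith [abs_nonneg (s - t)]
  · simp [spike_of_ne hb _ hk]

/-- Flipping `y` at the isolated point `a` flips `γ y` at some isolated point. -/
theorem exists_inv_flipAt (H : IsNonexpansiveBallHomeo φ γ)
    (hiso : Dense {x : K | IsIsolatedPoint x}) {y : C(K, ℝ)} (hy : IsUnimodular y) {a : K}
    (ha : IsIsolatedPoint a) :
    ∃ b, ∃ hb : IsIsolatedPoint b, γ (flipAt ha y) = flipAt hb (γ y) := by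
  have hx := H.inv_unimodular hiso hy
  have hx' := H.inv_unimodular hiso (hy.flipAt ha)
  have hne : ¬ ∀ c, IsIsolatedPoint c → γ y c = γ (flipAt ha y) c := by
    intro h
    have e := H.inv_injective hy.abs_le (hy.flipAt ha).abs_le
      (ContinuousMap.eq_of_isolated hiso h)
    have := congrArg (fun f : C(K, ℝ) => f a) e
    simp only [flipAt_self] at this
    rcases hy a with h | h <;> rw [h] at this <;> linarith
  push Not at hne
  obtain ⟨b, hb, hbne⟩ := hne
  refine ⟨b, hb, ContinuousMap.eq_of_isolated hiso fun c hc => ?_⟩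
  by_cases hcb : c = b
  · subst hcb
    rw [flipAt_self]
    rcases hx c with h | h <;> rcases hx' c with h' | h' <;> rw [h, h'] at hbne ⊢ <;> simp at *
  rw [flipAt_of_ne hb _ hcb]
  by_contra hcne
  -- Wherever the two sign functions differ, the spike with the sign of `γ y` lies in the orthant of
  -- `γ y` and opposite to that of the flip, so its image lives on one half-line at `a`.
  have supp : ∀ d (hd : IsIsolatedPoint d), γ y d ≠ γ (flipAt ha y) d → ∀ t ∈ Icc (0 : ℝ) 1,
      (∀ k, |spike hd (γ y d * t) k| ≤ 1) ∧ (∀ k, k ≠ a → φ (spike hd (γ y d * t)) k = 0) ∧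
      0 ≤ y a * φ (spike hd (γ y d * t)) a := by
    intro d hd hne t ht
    have hball : ∀ k, |spike hd (γ y d * t) k| ≤ 1 := abs_spike_le hd (by
      rw [abs_mul, abs_of_nonneg ht.1]; nlinarith [ht.1, ht.2, hx.abs_le d])
    have h1 : ∀ k, 0 ≤ γ y k * spike hd (γ y d * t) k := by
      intro k
      by_cases hk : k = d
      · subst hk
        rw [spike_self]
        rcases hx k with h | h <;> rw [h] <;> linarith [ht.1]
      · rw [spike_of_ne hd _ hk, mul_zero]
    have h2 : ∀ k, γ (flipAt ha y) k * spike hd (γ y d * t) k ≤ 0 := by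
      intro k
      by_cases hk : k = d
      · subst hk
        rw [spike_self]
        rcases hx k with h | h <;> rcases hx' k with h' | h' <;> rw [h, h'] at hne ⊢ <;>
          first | exact absurd rfl hne | linarith [ht.1]
      · rw [spike_of_ne hd _ hk, mul_zero]
    exact ⟨hball, fun k hk => H.map_eq_zero_of_opposite hiso hy ha hball h1 h2 hk,
      H.mul_map_nonneg hiso hy hball h1 a⟩
  have spike_zero : ∀ d (hd : IsIsolatedPoint d), spike hd (γ y d * 0) = 0 := by
    intro d hd
    ext k
    by_cases hk : k = d
    · subst hk; rw [spike_self, mul_zero]; rfl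
    · rw [spike_of_ne hd _ hk]; rfl
  have arc : ∀ d (hd : IsIsolatedPoint d), γ y d ≠ γ (flipAt ha y) d →
      ContinuousOn (fun t => y a * φ (spike hd (γ y d * t)) a) (Icc 0 1) ∧
      y a * φ (spike hd (γ y d * 0)) a = 0 ∧ 0 < y a * φ (spike hd (γ y d * 1)) a := by
    intro d hd hne
    refine ⟨continuousOn_const.mul (H.continuousOn_map_spike hd _ (hx.abs_le d) a), ?_, ?_⟩
    · rw [spike_zero, H.map_zero]; simp
    · obtain ⟨hball, h0, hnn⟩ := supp d hd hne 1 (by simp)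
      refine lt_of_le_of_ne hnn fun h => ?_
      have e : φ (spike hd (γ y d * 1)) = φ 0 := by
        rw [H.map_zero]
        ext k
        by_cases hk : k = a
        · subst hk
          rcases hy k with hy | hy <;> rw [hy] at h <;> simp at * <;> linarith
        · exact h0 k hk
      have := congrArg (fun f : C(K, ℝ) => f d) (H.injective hball (by simp) e)
      rcases hx d with h | h <;> simp [spike_self, h] at this
  obtain ⟨c1, c2, c3⟩ := arc c hc (Ne.symm hcne)
  obtain ⟨b1, b2, b3⟩ := arc b hb hbne
  -- Two points of difference would give two arcs in the same half-line. A common value with `s ≠ 0`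
  -- identifies the images of two distinct spikes.
  obtain ⟨s, hs, t, ht, hs0, e⟩ := exists_common_value b1 c1 b2 c2 b3 c3
  obtain ⟨s1, s2, -⟩ := supp b hb hbne s hs
  obtain ⟨t1, t2, -⟩ := supp c hc (Ne.symm hcne) t ht
  have e' : φ (spike hb (γ y b * s)) = φ (spike hc (γ y c * t)) := by
    ext k
    by_cases hk : k = a
    · subst hk
      rcases hy k with hy | hy <;> simp only [hy] at e <;> linarith
    · rw [s2 k hk, t2 k hk]
  have := congrArg (fun f : C(K, ℝ) => f b) (H.injective s1 t1 e')
  simp only [spike_self, spike_of_ne hc _ (Ne.symm hcb)] at this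
  rcases hx b with h | h <;> rw [h] at this <;> apply hs0 <;> linarith

end IsNonexpansiveBallHomeo

/-! ### Correspondence of isolated points -/

namespace IsNonexpansiveBallHomeo

variable {K : Type*} [TopologicalSpace K] {φ γ : C(K, ℝ) → C(K, ℝ)}

/-- The point `b` corresponds to `a`: the sign of `γ y` at `b` is that of `y` at `a`, up to a sign
that does not depend on `y`. -/
def Corresponds (γ : C(K, ℝ) → C(K, ℝ)) (a b : K) : Prop :=
  ∀ y, IsUnimodular y → γ y b = γ 1 b * y a

variable [T2Space K]

/-- The flip of `1` at `a` determines `b`, and the spike at `b` with the sign of `γ 1` has image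
supported and positive at `a`. If `y a = 1` but `γ y b` had the other sign, the orthant of `-y`
would make that image nonpositive at `a`. -/
theorem exists_corresponds (H : IsNonexpansiveBallHomeo φ γ)
    (hiso : Dense {x : K | IsIsolatedPoint x}) {a : K} (ha : IsIsolatedPoint a) :
    ∃ b, IsIsolatedPoint b ∧ Corresponds γ a b := by
  obtain ⟨b, hb, hflip⟩ := H.exists_inv_flipAt hiso IsUnimodular.one ha
  have hx1 := H.inv_unimodular hiso IsUnimodular.one
  have hball : ∀ k, |spike hb (γ 1 b) k| ≤ 1 := abs_spike_le hb (hx1.abs_le b)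
  have h1 : ∀ k, 0 ≤ γ 1 k * spike hb (γ 1 b) k := by
    intro k
    by_cases hk : k = b
    · subst hk; rw [spike_self]; exact mul_self_nonneg _
    · rw [spike_of_ne hb _ hk, mul_zero]
  have h2 : ∀ k, γ (flipAt ha 1) k * spike hb (γ 1 b) k ≤ 0 := by
    intro k
    rw [hflip]
    by_cases hk : k = b
    · subst hk; rw [spike_self, flipAt_self]; nlinarith [mul_self_nonneg (γ 1 k)]
    · rw [spike_of_ne hb _ hk, mul_zero]
  have p0 := fun k (hk : k ≠ a) =>
    H.map_eq_zero_of_opposite hiso IsUnimodular.one ha hball h1 h2 hk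
  have p1 := H.mul_map_nonneg hiso IsUnimodular.one hball h1 a
  have pne : φ (spike hb (γ 1 b)) a ≠ 0 := by
    intro h
    have e : φ (spike hb (γ 1 b)) = φ 0 := by
      rw [H.map_zero]
      ext k
      by_cases hk : k = a
      · subst hk; exact h
      · exact p0 k hk
    have := congrArg (fun f : C(K, ℝ) => f b) (H.injective hball (by simp) e)
    rcases hx1 b with h | h <;> simp [spike_self, h] at this
  have ppos : 0 < φ (spike hb (γ 1 b)) a := by
    rw [ContinuousMap.one_apply, one_mul] at p1
    exact lt_of_le_of_ne p1 pne.symm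
  have pos : ∀ y, IsUnimodular y → y a = 1 → γ y b = γ 1 b := by
    intro y hy hya
    by_contra hne
    have := H.mul_map_nonpos hiso hy hball (fun k => by
      by_cases hk : k = b
      · subst hk
        rw [spike_self]
        rcases hx1 k with h | h <;> rcases H.inv_unimodular hiso hy k with h' | h' <;>
          rw [h, h'] at hne ⊢ <;> first | exact absurd rfl hne | norm_num
      · rw [spike_of_ne hb _ hk, mul_zero]) a
    rw [hya, one_mul] at this
    linarith
  refine ⟨b, hb, fun y hy => ?_⟩
  rcases hy a with h | h
  · rw [h, mul_one, pos y hy h]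
  · have := pos (-y) hy.neg (by rw [ContinuousMap.neg_apply, h, neg_neg])
    rw [H.inv_neg hiso hy, ContinuousMap.neg_apply] at this
    rw [h]
    linarith

/-- The flip at `a` changes the sign at `b` by correspondence, so `b` is the only point that
`exists_inv_flipAt` can provide. -/
theorem Corresponds.inv_flipAt (H : IsNonexpansiveBallHomeo φ γ)
    (hiso : Dense {x : K | IsIsolatedPoint x}) {a b : K} (hab : Corresponds γ a b)
    (ha : IsIsolatedPoint a) (hb : IsIsolatedPoint b) {y : C(K, ℝ)} (hy : IsUnimodular y) :
    γ (flipAt ha y) = flipAt hb (γ y) := by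
  obtain ⟨c, hc, h⟩ := H.exists_inv_flipAt hiso hy ha
  have e : b = c := by
    by_contra hne
    have h1 := hab _ (hy.flipAt ha)
    rw [h, flipAt_of_ne hc _ hne, flipAt_self, mul_neg, ← hab y hy] at h1
    rcases H.inv_unimodular hiso hy b with h | h <;> rw [h] at h1 <;> norm_num at h1
  subst e
  exact h

theorem Corresponds.left_unique (H : IsNonexpansiveBallHomeo φ γ)
    (hiso : Dense {x : K | IsIsolatedPoint x}) {a a' b : K} (ha : IsIsolatedPoint a)
    (h : Corresponds γ a b) (h' : Corresponds γ a' b) : a = a' := by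
  by_contra hne
  have h1 := h _ (IsUnimodular.one.flipAt ha)
  have h2 := h' _ (IsUnimodular.one.flipAt ha)
  rw [flipAt_self] at h1
  rw [flipAt_of_ne ha _ (Ne.symm hne)] at h2
  rcases H.inv_unimodular hiso IsUnimodular.one b with h | h <;> rw [h] at h1 h2 <;>
    simp at h1 h2 <;> linarith

/-- If `b` were missed, the spike at `b` would lie in the orthants of `γ 1` and of `γ` of every flip
of `1`, so its image would vanish at all isolated points. -/
theorem exists_corresponds_left (H : IsNonexpansiveBallHomeo φ γ)
    (hiso : Dense {x : K | IsIsolatedPoint x}) {b : K} (hb : IsIsolatedPoint b) :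
    ∃ a, IsIsolatedPoint a ∧ Corresponds γ a b := by
  have hx1 := H.inv_unimodular hiso IsUnimodular.one
  have hball : ∀ k, |spike hb (γ 1 b) k| ≤ 1 := abs_spike_le hb (hx1.abs_le b)
  have h1 : ∀ k, 0 ≤ γ 1 k * spike hb (γ 1 b) k := by
    intro k
    by_cases hk : k = b
    · subst hk; rw [spike_self]; exact mul_self_nonneg _
    · rw [spike_of_ne hb _ hk, mul_zero]
  by_contra hno
  have e : φ (spike hb (γ 1 b)) = φ 0 := by
    rw [H.map_zero]
    refine ContinuousMap.eq_of_isolated hiso fun a ha => ?_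
    obtain ⟨c, hc, hac⟩ := H.exists_corresponds hiso ha
    have hcb : b ≠ c := by rintro rfl; exact hno ⟨a, ha, hac⟩
    have p1 := H.mul_map_nonneg hiso IsUnimodular.one hball h1 a
    have p2 := H.mul_map_nonneg hiso (IsUnimodular.one.flipAt ha) hball (fun k => by
      rw [hac.inv_flipAt H hiso ha hc IsUnimodular.one]
      by_cases hk : k = b
      · subst hk; rw [flipAt_of_ne hc _ hcb]; exact h1 k
      · rw [spike_of_ne hb _ hk, mul_zero]) a
    rw [flipAt_self] at p2
    simp only [ContinuousMap.one_apply, ContinuousMap.zero_apply] at *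
    linarith
  have := congrArg (fun f : C(K, ℝ) => f b) (H.injective hball (by simp) e)
  rcases hx1 b with h | h <;> simp [spike_self, h] at this

/-! ### One-sided estimates on orthants -/

/-- On the orthant of `γ y`, the map `φ` does not increase absolute values at corresponding
points. -/
theorem mul_map_le (H : IsNonexpansiveBallHomeo φ γ)
    (hiso : Dense {x : K | IsIsolatedPoint x}) {a b : K} (hab : Corresponds γ a b)
    (ha : IsIsolatedPoint a) (hb : IsIsolatedPoint b) {y : C(K, ℝ)} (hy : IsUnimodular y)
    {g : C(K, ℝ)} (hg : ∀ k, |g k| ≤ 1) (h : ∀ k, 0 ≤ γ y k * g k) :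
    y a * φ g a ≤ γ y b * g b := by
  have hx := H.inv_unimodular hiso hy
  have hx' := H.inv_unimodular hiso (hy.flipAt ha)
  -- The test point is within `1 / 2` of `g` off `b` and at distance `1 / 2 + γ y b * g b` at `b`;
  -- its image takes the value `-y a / 2` at `a`.
  have := H.nonexpansive g ((1 / 2 : ℝ) • γ (flipAt ha y)) hg
    (fun k => (abs_smul_le (by norm_num) hx'.abs_le k).trans (by norm_num))
    (1 / 2 + γ y b * g b) (by linarith [h b]) (fun k => by
      rw [hab.inv_flipAt H hiso ha hb hy, ContinuousMap.smul_apply, smul_eq_mul]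
      have hk0 := h k
      have hb0 := h b
      have hk1 := abs_le.1 (hg k)
      by_cases hk : k = b
      · subst hk
        rw [flipAt_self, abs_le]
        rcases hx k with e | e <;> rw [e] at hk0 ⊢ <;> constructor <;> linarith
      · rw [flipAt_of_ne hb _ hk, abs_le]
        rcases hx k with e | e <;> rw [e] at hk0 ⊢ <;> constructor <;> linarith) a
  rw [H.map_smul_inv (hy.flipAt ha) (by norm_num) (by norm_num), ContinuousMap.smul_apply,
    smul_eq_mul, flipAt_self, abs_le] at this
  rcases hy a with e | e <;> rw [e] at this ⊢ <;> linarith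

variable [CompactSpace K]

omit [T2Space K] [CompactSpace K] in
theorem isClosed_forall_nonneg (x : C(K, ℝ)) : IsClosed {h : C(K, ℝ) | ∀ k, 0 ≤ x k * h k} := by
  simp only [ofPred_forall]
  exact isClosed_iInter fun k =>
    isClosed_le continuous_const (continuous_const.mul (continuous_eval_const k))

/-- The image under `γ` of the segment from `y` to `f` stays in the orthant of `γ y`. -/
theorem mul_inv_nonneg_of_le (H : IsNonexpansiveBallHomeo φ γ)
    (hiso : Dense {x : K | IsIsolatedPoint x}) {y : C(K, ℝ)} (hy : IsUnimodular y)
    {f : C(K, ℝ)} (hf : ∀ k, |f k| ≤ 1) {δ : ℝ} (hδ : 0 < δ) (h : ∀ k, δ ≤ y k * f k) (k : K) :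
    0 ≤ γ y k * γ f k := by
  have hx := H.inv_unimodular hiso hy
  have hδ1 : ∀ k, δ ≤ 1 := fun k => (h k).trans (by
    have := abs_le.1 (hf k)
    rcases hy k with e | e <;> rw [e] <;> linarith)
  let p : unitInterval → C(K, ℝ) := fun s => (1 - (s : ℝ)) • y + (s : ℝ) • f
  have hp : Continuous p := by fun_prop
  have hval : ∀ s k, δ ≤ y k * p s k := by
    intro s k
    have e : y k * p s k = (1 - (s : ℝ)) * (y k * y k) + s * (y k * f k) := by
      simp only [p, ContinuousMap.add_apply, ContinuousMap.smul_apply, smul_eq_mul]; ring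
    have e1 : y k * y k = 1 := by rcases hy k with e | e <;> rw [e] <;> norm_num
    rw [e, e1]
    nlinarith [h k, hδ1 k, s.2.1, s.2.2]
  have hball : ∀ s k, |p s k| ≤ 1 := by
    intro s k
    simp only [p, ContinuousMap.add_apply, ContinuousMap.smul_apply, smul_eq_mul]
    have h1 := abs_le.1 (hf k)
    have h2 := abs_le.1 (hy.abs_le k)
    rw [abs_le]
    constructor <;> nlinarith [s.2.1, s.2.2]
  have hq : Continuous fun s => γ (p s) :=
    H.continuousOn_inv.comp_continuous hp fun s => hball s
  let A : Set unitInterval := {s | ∀ k, 0 ≤ γ y k * γ (p s) k}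
  have hA : IsClosed A := (isClosed_forall_nonneg (γ y)).preimage hq
  -- Nonnegativity improves itself to the bound `δ`; this gap makes the closed set `A` open.
  have hAδ : ∀ s ∈ A, ∀ k, δ ≤ γ y k * γ (p s) k := by
    intro s hs k
    refine forall_of_isolated hiso (isClosed_le continuous_const
      ((γ y).continuous.mul (γ (p s)).continuous)) (fun b hb => ?_) k
    obtain ⟨a, ha, hab⟩ := H.exists_corresponds_left hiso hb
    have := H.mul_map_le hiso hab ha hb hy (H.abs_inv_le _ (hball s)) hs
    rw [H.right_inv _ (hball s)] at this
    exact (hval s a).trans this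
  have hAo : IsOpen A := by
    rw [isOpen_iff_mem_nhds]
    intro s hs
    filter_upwards [hq.continuousAt (Metric.ball_mem_nhds _ hδ)] with t ht k
    have h1 := (ContinuousMap.dist_apply_le_dist k).trans_lt (Metric.mem_ball.1 ht)
    rw [Real.dist_eq, abs_lt] at h1
    have h2 := hAδ s hs k
    rcases hx k with e | e <;> rw [e] at h2 ⊢ <;> linarith
  have huniv : A = univ := IsClopen.eq_univ ⟨hA, hAo⟩ ⟨0, fun k => by
    have : p 0 = y := by simp [p]
    rw [this]
    exact mul_self_nonneg _⟩
  have h1 : (1 : unitInterval) ∈ A := huniv ▸ mem_univ _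
  have : p 1 = f := by simp [p]
  simpa only [A, mem_ofPred_eq, this] using h1 k

/-- The orthant of `y` is mapped by `γ` into the orthant of `γ y`. -/
theorem mul_inv_nonneg (H : IsNonexpansiveBallHomeo φ γ)
    (hiso : Dense {x : K | IsIsolatedPoint x}) {y : C(K, ℝ)} (hy : IsUnimodular y)
    {f : C(K, ℝ)} (hf : ∀ k, |f k| ≤ 1) (h : ∀ k, 0 ≤ y k * f k) (k : K) :
    0 ≤ γ y k * γ f k := by
  let p : unitInterval → C(K, ℝ) := fun s => (1 - (s : ℝ)) • f + (s : ℝ) • y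
  have hp : Continuous p := by fun_prop
  have hball : ∀ s k, |p s k| ≤ 1 := by
    intro s k
    simp only [p, ContinuousMap.add_apply, ContinuousMap.smul_apply, smul_eq_mul]
    have h1 := abs_le.1 (hf k)
    have h2 := abs_le.1 (hy.abs_le k)
    rw [abs_le]
    constructor <;> nlinarith [s.2.1, s.2.2]
  have hq : Continuous fun s => γ (p s) :=
    H.continuousOn_inv.comp_continuous hp fun s => hball s
  have hA : IsClosed {s | ∀ k, 0 ≤ γ y k * γ (p s) k} :=
    (isClosed_forall_nonneg (γ y)).preimage hq
  -- For `s > 0` the point `p s` is at least `s` in its orthant, so the strict case applies with `δ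
  -- = s`.
  have hpos : Ioi (0 : unitInterval) ⊆ {s | ∀ k, 0 ≤ γ y k * γ (p s) k} := by
    intro s hs
    refine H.mul_inv_nonneg_of_le hiso hy (hball s) (δ := s) hs fun k => ?_
    have e : y k * p s k = (1 - (s : ℝ)) * (y k * f k) + s * (y k * y k) := by
      simp only [p, ContinuousMap.add_apply, ContinuousMap.smul_apply, smul_eq_mul]; ring
    have e1 : y k * y k = 1 := by rcases hy k with e | e <;> rw [e] <;> norm_num
    rw [e, e1]
    nlinarith [h k, s.2.1, s.2.2, mul_nonneg (sub_nonneg.2 s.2.2) (h k)]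
  have h0 : (0 : unitInterval) ∈ closure (Ioi 0) := by
    rw [closure_Ioi' ⟨1, by simp⟩]; exact self_mem_Ici
  have := closure_minimal hpos hA h0 k
  have e : p 0 = f := by simp [p]
  simpa only [e] using this

end IsNonexpansiveBallHomeo

/-! ### Comparison of signs, moduli and zeros -/

/-- Every function is approximated by functions lying in an orthant and dominated by it. -/
theorem IsZeroDimensional.exists_mul_nonneg {K : Type*} [TopologicalSpace K] [CompactSpace K]
    [T2Space K] (hK : IsZeroDimensional K) (f : C(K, ℝ)) {η : ℝ} (hη : 0 < η) :
    ∃ f' y : C(K, ℝ), IsUnimodular y ∧ (∀ k, 0 ≤ y k * f' k) ∧ (∀ k, |f' k| ≤ |f k|) ∧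
      dist f' f ≤ η := by
  -- `V` contains `{f ≥ η}` and lies in `{f > 0}`; cutting positive values to zero off `V` costs at
  -- most `η`.
  obtain ⟨V, hV, h1, h2⟩ := hK.exists_isClopen_levels f hη
  refine ⟨clopenPiecewise hV f (f ⊓ 0), clopenPiecewise hV 1 (-1), fun k => ?_, fun k => ?_,
    fun k => ?_, (ContinuousMap.dist_le hη.le).2 fun k => ?_⟩ <;> by_cases hk : k ∈ V
  · left; rw [clopenPiecewise_of_mem hV _ _ hk]; rfl
  · right; rw [clopenPiecewise_of_notMem hV _ _ hk]; rfl
  · rw [clopenPiecewise_of_mem hV _ _ hk, clopenPiecewise_of_mem hV _ _ hk]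
    simpa using (h2 k hk).le
  · rw [clopenPiecewise_of_notMem hV _ _ hk, clopenPiecewise_of_notMem hV _ _ hk]
    simp
  · rw [clopenPiecewise_of_mem hV _ _ hk]
  · rw [clopenPiecewise_of_notMem hV _ _ hk, ContinuousMap.inf_apply, ContinuousMap.zero_apply]
    rcases le_total (f k) 0 with h | h
    · rw [inf_eq_left.2 h]
    · rw [inf_eq_right.2 h]; simp
  · rw [clopenPiecewise_of_mem hV _ _ hk, dist_self]; exact hη.le
  · rw [clopenPiecewise_of_notMem hV _ _ hk, ContinuousMap.inf_apply, ContinuousMap.zero_apply,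
      Real.dist_eq]
    have : f k < η := lt_of_not_ge fun h => hk (h1 k h)
    rcases le_total (f k) 0 with h | h
    · rw [inf_eq_left.2 h]; simpa using hη.le
    · rw [inf_eq_right.2 h, zero_sub, abs_neg, abs_of_nonneg h]; exact this.le

namespace IsNonexpansiveBallHomeo

variable {K : Type*} [TopologicalSpace K] [CompactSpace K] [T2Space K]
  {φ γ : C(K, ℝ) → C(K, ℝ)}

theorem compare_of_mul_nonneg (H : IsNonexpansiveBallHomeo φ γ)
    (hiso : Dense {x : K | IsIsolatedPoint x}) {a b : K} (hab : Corresponds γ a b)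
    (ha : IsIsolatedPoint a) (hb : IsIsolatedPoint b) {y : C(K, ℝ)} (hy : IsUnimodular y)
    {f : C(K, ℝ)} (hf : ∀ k, |f k| ≤ 1) (h : ∀ k, 0 ≤ y k * f k) :
    |f a| ≤ |γ f b| ∧ 0 ≤ γ 1 b * f a * γ f b ∧ (f a = 0 → γ f b = 0) := by
  have hx := H.inv_unimodular hiso hy
  have h1 := H.mul_inv_nonneg hiso hy hf h
  have h2 := H.mul_map_le hiso hab ha hb hy (H.abs_inv_le f hf) h1
  rw [H.right_inv f hf] at h2
  have abs_eq : ∀ {u v : ℝ}, (u = 1 ∨ u = -1) → |v| = |u * v| := by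
    rintro u v (rfl | rfl) <;> simp
  refine ⟨?_, ?_, fun h0 => ?_⟩
  · calc |f a| = y a * f a := by rw [abs_eq (hy a), abs_of_nonneg (h a)]
      _ ≤ γ y b * γ f b := h2
      _ = |γ f b| := by rw [abs_eq (hx b), abs_of_nonneg (h1 b)]
  · have e : γ 1 b * f a * γ f b = (y a * f a) * (γ y b * γ f b) := by
      rw [hab y hy]
      rcases hy a with e | e <;> rw [e] <;> ring
    rw [e]
    exact mul_nonneg (h a) (h1 b)
  -- If `f a = 0`, then `f` also lies in the orthant of the flipped `y`, so `γ f b` has both signs.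
  · have h3 := H.mul_inv_nonneg hiso (hy.flipAt ha) hf (fun k => by
      by_cases hk : k = a
      · subst hk; rw [h0, mul_zero]
      · rw [flipAt_of_ne ha _ hk]; exact h k) b
    have h4 := h1 b
    rw [hab.inv_flipAt H hiso ha hb hy, flipAt_self] at h3
    rcases hx b with e | e <;> rw [e] at h3 h4 <;> linarith

/-- At corresponding points `γ` preserves signs up to a fixed factor, does not decrease absolute
values, and preserves zeros. -/
theorem compare (H : IsNonexpansiveBallHomeo φ γ) (hK : IsZeroDimensional K)
    (hiso : Dense {x : K | IsIsolatedPoint x}) {a b : K} (hab : Corresponds γ a b)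
    (ha : IsIsolatedPoint a) (hb : IsIsolatedPoint b) {f : C(K, ℝ)} (hf : ∀ k, |f k| ≤ 1) :
    |f a| ≤ |γ f b| ∧ 0 ≤ γ 1 b * f a * γ f b ∧ (f a = 0 → γ f b = 0) := by
  choose u y hy hyu hle hdist using fun n : ℕ =>
    hK.exists_mul_nonneg f (η := 1 / ((n : ℝ) + 1)) (by positivity)
  have hball : ∀ n k, |u n k| ≤ 1 := fun n k => (hle n k).trans (hf k)
  have key := fun n => H.compare_of_mul_nonneg hiso hab ha hb (hy n) (hball n) (hyu n)
  have lim : Tendsto u atTop (𝓝 f) :=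
    tendsto_iff_dist_tendsto_zero.2 (squeeze_zero (fun _ => dist_nonneg) hdist
      tendsto_one_div_add_atTop_nhds_zero_nat)
  have limγ : Tendsto (fun n => γ (u n)) atTop (𝓝 (γ f)) :=
    (H.continuousOn_inv f hf).tendsto.comp
      (tendsto_nhdsWithin_iff.2 ⟨lim, Eventually.of_forall hball⟩)
  have la : Tendsto (fun n => u n a) atTop (𝓝 (f a)) :=
    ((continuous_eval_const a).tendsto f).comp lim
  have lb : Tendsto (fun n => γ (u n) b) atTop (𝓝 (γ f b)) :=
    ((continuous_eval_const b).tendsto (γ f)).comp limγ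
  refine ⟨le_of_tendsto_of_tendsto' la.abs lb.abs fun n => (key n).1,
    ge_of_tendsto' ((la.const_mul _).mul lb) fun n => (key n).2.1, fun h0 => ?_⟩
  -- Preservation of zeros is not a closed condition; it survives the limit because `|u n| ≤ |f|`
  -- makes each `u n` vanish at `a`.
  have hz : ∀ n, γ (u n) b = 0 := fun n => (key n).2.2 (by
    have := hle n a
    rw [h0, abs_zero] at this
    exact abs_eq_zero.1 (le_antisymm this (abs_nonneg _)))
  simp only [hz] at lb
  exact tendsto_nhds_unique lb tendsto_const_nhds

theorem compare_map (H : IsNonexpansiveBallHomeo φ γ) (hK : IsZeroDimensional K)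
    (hiso : Dense {x : K | IsIsolatedPoint x}) {a b : K} (hab : Corresponds γ a b)
    (ha : IsIsolatedPoint a) (hb : IsIsolatedPoint b) {g : C(K, ℝ)} (hg : ∀ k, |g k| ≤ 1) :
    |φ g a| ≤ |g b| ∧ 0 ≤ γ 1 b * φ g a * g b ∧ (φ g a = 0 → g b = 0) := by
  have := H.compare hK hiso hab ha hb (H.abs_map_le g hg)
  rwa [H.left_inv g hg] at this

/-- Reals of the same sign up to a unimodular factor are determined by their absolute values. -/
theorem eq_mul_of_abs_eq {e p q : ℝ} (he : e = 1 ∨ e = -1) (h : 0 ≤ e * p * q)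
    (hpq : |p| = |q|) : p = e * q := by
  rcases abs_eq_abs.1 hpq with rfl | rfl <;> rcases he with rfl | rfl
  · ring
  · nlinarith [mul_self_nonneg p]
  · nlinarith [mul_self_nonneg q]
  · ring

/-! ### Weighted composition on the half-radius ball -/

/-- `compare` forces modulus at least `1` at `b`, where the ball allows no more, and zero at the
other isolated points. -/
theorem inv_spike (H : IsNonexpansiveBallHomeo φ γ) (hK : IsZeroDimensional K)
    (hiso : Dense {x : K | IsIsolatedPoint x}) {a b : K} (hab : Corresponds γ a b)
    (ha : IsIsolatedPoint a) (hb : IsIsolatedPoint b) {s : ℝ} (hs : |s| = 1) :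
    γ (spike ha s) = spike hb (γ 1 b * s) := by
  have hball : ∀ k, |spike ha s k| ≤ 1 := abs_spike_le ha hs.le
  refine ContinuousMap.eq_of_isolated hiso fun c hc => ?_
  obtain ⟨d, hd, hdc⟩ := H.exists_corresponds_left hiso hc
  obtain ⟨h1, h2, h3⟩ := H.compare hK hiso hdc hd hc hball
  have hε := H.inv_unimodular hiso IsUnimodular.one
  by_cases hcb : c = b
  · subst hcb
    obtain rfl := hdc.left_unique H hiso hd hab
    rw [spike_self] at h1 h2 ⊢
    have h4 := H.abs_inv_le _ hball c
    have := eq_mul_of_abs_eq (hε c) h2 (le_antisymm h1 (h4.trans hs.ge))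
    rcases hε c with e | e <;> rw [e] at this ⊢ <;> linarith
  · rw [spike_of_ne hb _ hcb]
    refine h3 (spike_of_ne ha _ ?_)
    rintro rfl
    exact hcb (by
      have e := hdc.inv_flipAt H hiso hd hc IsUnimodular.one
      have e' := congrArg (fun f : C(K, ℝ) => f b) e
      simp only [hab.inv_flipAt H hiso hd hb IsUnimodular.one, flipAt_self,
        flipAt_of_ne hc _ (Ne.symm hcb)] at e'
      rcases hε b with e | e <;> rw [e] at e' <;> norm_num at e')

theorem map_spike (H : IsNonexpansiveBallHomeo φ γ) (hK : IsZeroDimensional K)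
    (hiso : Dense {x : K | IsIsolatedPoint x}) {a b : K} (hab : Corresponds γ a b)
    (ha : IsIsolatedPoint a) (hb : IsIsolatedPoint b) {s : ℝ} (hs : |s| = 1) :
    φ (spike hb (γ 1 b * s)) = spike ha s := by
  rw [← H.inv_spike hK hiso hab ha hb hs, H.right_inv _ (abs_spike_le ha hs.le)]

/-- On the half-radius ball `φ` is a weighted composition. -/
theorem map_apply_of_abs_le_half (H : IsNonexpansiveBallHomeo φ γ) (hK : IsZeroDimensional K)
    (hiso : Dense {x : K | IsIsolatedPoint x}) {a b : K} (hab : Corresponds γ a b)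
    (ha : IsIsolatedPoint a) (hb : IsIsolatedPoint b) {h : C(K, ℝ)}
    (hh : ∀ k, |h k| ≤ 1 / 2) : φ h a = γ 1 b * h b := by
  have hε := H.inv_unimodular hiso IsUnimodular.one b
  -- Since `|h| ≤ 1 / 2`, the distance from `h` to a unit spike at `b` is attained at `b`; the
  -- spikes of both signs bound `φ h a` from both sides.
  have key : ∀ s : ℝ, (s = 1 ∨ s = -1) → |φ h a - s| ≤ 1 - s * (γ 1 b * h b) := by
    intro s hs
    have hs1 : |s| = 1 := by rcases hs with rfl | rfl <;> simp
    have hb' := abs_le.1 (hh b)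
    have := H.nonexpansive h (spike hb (γ 1 b * s)) (fun k => (hh k).trans (by norm_num))
      (abs_spike_le hb (by rcases hε with e | e <;> rw [e] <;> simp [hs1]))
      (1 - s * (γ 1 b * h b))
      (by rcases hε with e | e <;> rcases hs with rfl | rfl <;> rw [e] <;> linarith)
      (fun k => by
        by_cases hk : k = b
        · subst hk
          rw [spike_self, abs_le]
          rcases hε with e | e <;> rcases hs with rfl | rfl <;> rw [e] <;> constructor <;>
            linarith
        · rw [spike_of_ne hb _ hk, sub_zero]
          refine (hh k).trans ?_
          rcases hε with e | e <;> rcases hs with rfl | rfl <;> rw [e] <;> linarith) a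
    rwa [H.map_spike hK hiso hab ha hb hs1, spike_self] at this
  have h1 := abs_le.1 (key 1 (Or.inl rfl))
  have h2 := abs_le.1 (key (-1) (Or.inr rfl))
  linarith [h1.1, h2.2]

/-! ### Bootstrap of the reverse inequality -/

/-- If `φ` does not lower absolute values below the level `r`, then it is a weighted composition
on the functions all of whose values are small or unimodular. -/
theorem map_apply_of_levels (H : IsNonexpansiveBallHomeo φ γ) (hK : IsZeroDimensional K)
    (hiso : Dense {x : K | IsIsolatedPoint x}) {r r' : ℝ}
    (hr : ∀ a b, IsIsolatedPoint a → IsIsolatedPoint b → Corresponds γ a b →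
      ∀ g : C(K, ℝ), (∀ k, |g k| ≤ 1) → min |g b| r ≤ |φ g a|)
    (hr' : r' < r ∨ r' = 0) {w : C(K, ℝ)} (hw1 : ∀ k, |w k| ≤ 1)
    (hw : ∀ k, |w k| = 1 ∨ |w k| ≤ r') {a b : K} (ha : IsIsolatedPoint a)
    (hb : IsIsolatedPoint b) (hab : Corresponds γ a b) : φ w a = γ 1 b * w b := by
  have hhalf : ∀ k, |((1 / 2 : ℝ) • w) k| ≤ 1 / 2 := abs_smul_le (by norm_num) hw1
  have hε := H.inv_unimodular hiso IsUnimodular.one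
  -- Applying `φ` in the half-radius ball and rescaling realizes the weighted composition of `w` as
  -- a continuous function; it remains to see that `γ f = w`.
  let f : C(K, ℝ) := (2 : ℝ) • φ ((1 / 2 : ℝ) • w)
  have hf : ∀ a b, IsIsolatedPoint a → IsIsolatedPoint b → Corresponds γ a b →
      f a = γ 1 b * w b := by
    intro a b ha hb hab
    simp only [f, ContinuousMap.smul_apply, smul_eq_mul,
      H.map_apply_of_abs_le_half hK hiso hab ha hb hhalf]
    ring
  have habs : ∀ a b, IsIsolatedPoint a → IsIsolatedPoint b → Corresponds γ a b →
      |f a| = |w b| := by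
    intro a b ha hb hab
    rw [hf a b ha hb hab, abs_mul]
    rcases hε b with e | e <;> rw [e] <;> simp
  have hf1 : ∀ k, |f k| ≤ 1 := by
    refine forall_of_isolated hiso (isClosed_le f.continuous.abs continuous_const) fun c hc => ?_
    obtain ⟨d, hd, hcd⟩ := H.exists_corresponds hiso hc
    rw [habs c d hc hd hcd]
    exact hw1 d
  have hγ : γ f = w := by
    refine ContinuousMap.eq_of_isolated hiso fun d hd => ?_
    obtain ⟨c, hc, hcd⟩ := H.exists_corresponds_left hiso hd
    obtain ⟨h1, h2, h3⟩ := H.compare hK hiso hcd hc hd hf1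
    -- Unimodular values cannot grow inside the ball. Values below `r` cannot grow by hypothesis,
    -- and for `r' = 0` it is enough that zeros are kept.
    have hle : |γ f d| ≤ |f c| := by
      rcases hw d with h | h
      · rw [habs c d hc hd hcd, h]
        exact H.abs_inv_le f hf1 d
      · rcases hr' with h' | h'
        · have h4 := hr c d hc hd hcd (γ f) (H.abs_inv_le f hf1)
          rw [H.right_inv f hf1] at h4
          rcases min_le_iff.1 h4 with h5 | h5
          · exact h5
          · rw [habs c d hc hd hcd] at h5
            linarith
        · rw [h'] at h
          rw [h3 (by
            rw [hf c d hc hd hcd, abs_eq_zero.1 (le_antisymm h (abs_nonneg _)), mul_zero]),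
            abs_zero]
          exact abs_nonneg _
    have h5 := eq_mul_of_abs_eq (hε d) h2 (le_antisymm h1 hle)
    rw [hf c d hc hd hcd] at h5
    rcases hε d with e | e <;> rw [e] at h5 <;> linarith
  rw [← hγ, H.right_inv f hf1, hγ, hf a b ha hb hab]

omit [T2Space K] [CompactSpace K] in
/-- Truncation of a function at the levels `±r`. -/
theorem exists_truncation (g : C(K, ℝ)) {r : ℝ} (hr : 0 ≤ r) :
    ∃ c : C(K, ℝ), (∀ k, |c k| ≤ r) ∧ ∀ k t, r ≤ t → |g k| ≤ t → |g k - c k| ≤ t - r := by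
  refine ⟨(g ⊓ ContinuousMap.const K r) ⊔ ContinuousMap.const K (-r), fun k => ?_,
    fun k t hrt hgt => ?_⟩
  · simp only [ContinuousMap.sup_apply, ContinuousMap.inf_apply, ContinuousMap.const_apply]
    exact abs_le.2 ⟨le_sup_right, sup_le inf_le_right (by linarith)⟩
  · simp only [ContinuousMap.sup_apply, ContinuousMap.inf_apply, ContinuousMap.const_apply]
    rw [abs_le] at hgt ⊢
    rcases le_total (g k) r with h | h
    · rw [inf_eq_left.2 h]
      rcases le_total (g k) (-r) with h' | h'
      · rw [sup_eq_right.2 h']; constructor <;> linarith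
      · rw [sup_eq_left.2 h']; constructor <;> linarith
    · rw [inf_eq_right.2 h, sup_eq_left.2 (by linarith)]; constructor <;> linarith

/-- Approximation of `g` by a function whose values are small or unimodular. -/
theorem exists_levels_approx (hK : IsZeroDimensional K) {g : C(K, ℝ)}
    (hg : ∀ k, |g k| ≤ 1) {r s : ℝ} (hr : 0 ≤ r) (hs1 : s ≤ 1)
    (hrs : s < (1 + r) / 2) :
    ∃ w : C(K, ℝ), (∀ k, |w k| = 1 ∨ |w k| ≤ r) ∧ ∀ k, |g k - w k| ≤ 1 - s := by
  obtain ⟨c, hc1, hc2⟩ := exists_truncation g hr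
  -- On `V` and `W` the distance from `g` to `±1` is below `1 - s`. Elsewhere `|g| < (1 + r) / 2`,
  -- so for `r ≤ 1` truncation at `r` costs at most `(1 - r) / 2 < 1 - s`.
  obtain ⟨V, hV, hV1, hV2⟩ := hK.exists_isClopen_levels g hrs
  obtain ⟨W, hW, hW1, hW2⟩ := hK.exists_isClopen_levels (-g) hrs
  refine ⟨clopenPiecewise hV 1 (clopenPiecewise hW (-1) c), fun k => ?_, fun k => ?_⟩ <;>
    by_cases hk : k ∈ V
  · left; rw [clopenPiecewise_of_mem hV _ _ hk]; simp
  · rw [clopenPiecewise_of_notMem hV _ _ hk]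
    by_cases hk' : k ∈ W
    · left; rw [clopenPiecewise_of_mem hW _ _ hk']; simp
    · right; rw [clopenPiecewise_of_notMem hW _ _ hk']; exact hc1 k
  · have h1 := hV2 k hk
    have h2 := abs_le.1 (hg k)
    rw [clopenPiecewise_of_mem hV _ _ hk, ContinuousMap.one_apply, abs_le]
    constructor <;> linarith
  · rw [clopenPiecewise_of_notMem hV _ _ hk]
    have h2 := abs_le.1 (hg k)
    by_cases hk' : k ∈ W
    · have h1 := hW2 k hk'
      rw [ContinuousMap.neg_apply] at h1
      rw [clopenPiecewise_of_mem hW _ _ hk', ContinuousMap.neg_apply, ContinuousMap.one_apply,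
        abs_le]
      constructor <;> linarith
    · rw [clopenPiecewise_of_notMem hW _ _ hk']
      have h3 : g k < (1 + r) / 2 := lt_of_not_ge fun h => hk (hV1 k h)
      have h4 : -g k < (1 + r) / 2 := lt_of_not_ge fun h => hk' (hW1 k h)
      rcases le_total r 1 with h | h
      · have := hc2 k ((1 + r) / 2) (by linarith) (abs_le.2 ⟨by linarith, h3.le⟩)
        linarith
      · have := hc2 k r le_rfl ((hg k).trans h)
        linarith

/-- The level below which `φ` does not lower absolute values can be raised. -/
theorem raise_level (H : IsNonexpansiveBallHomeo φ γ) (hK : IsZeroDimensional K)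
    (hiso : Dense {x : K | IsIsolatedPoint x}) {r r' s : ℝ}
    (hr : ∀ a b, IsIsolatedPoint a → IsIsolatedPoint b → Corresponds γ a b →
      ∀ g : C(K, ℝ), (∀ k, |g k| ≤ 1) → min |g b| r ≤ |φ g a|)
    (hr' : r' < r ∨ r' = 0) (hr0 : 0 ≤ r') (hr1 : r' ≤ 1) (hs1 : s ≤ 1)
    (hs : s < (1 + r') / 2) {a b : K} (ha : IsIsolatedPoint a)
    (hb : IsIsolatedPoint b) (hab : Corresponds γ a b) {g : C(K, ℝ)} (hg : ∀ k, |g k| ≤ 1) :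
    min |g b| s ≤ |φ g a| := by
  obtain ⟨w, hw1, hw2⟩ := exists_levels_approx hK hg hr0 hs1 hs
  obtain ⟨δ, hδ, hgδ⟩ : ∃ δ : ℝ, |δ| = 1 ∧ |g b - δ| = 1 - |g b| := by
    have h := abs_le.1 (hg b)
    rcases le_total 0 (g b) with h0 | h0
    · exact ⟨1, abs_one, by rw [abs_of_nonneg h0, abs_of_nonpos (by linarith)]; ring⟩
    · exact ⟨-1, by simp, by rw [abs_of_nonpos h0, abs_of_nonneg (by linarith)]; ring⟩
  -- Replacing the value at `b` by the nearest sign keeps `v` within `1 - min |g b| s` of `g`, while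
  -- `φ v a` has modulus `1`.
  let v : C(K, ℝ) := clopenPiecewise hb.isClopen (ContinuousMap.const K δ) w
  have hvb : v b = δ := clopenPiecewise_of_mem _ _ _ rfl
  have hvk : ∀ k, k ≠ b → v k = w k := fun k hk => clopenPiecewise_of_notMem _ _ _ hk
  have hv : ∀ k, |v k| = 1 ∨ |v k| ≤ r' := by
    intro k
    by_cases hk : k = b
    · subst hk; left; rw [hvb, hδ]
    · rw [hvk k hk]; exact hw1 k
  have hv1 : ∀ k, |v k| ≤ 1 := fun k => (hv k).elim le_of_eq fun h => h.trans hr1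
  have hm := min_le_left |g b| s
  have hm' := min_le_right |g b| s
  have key := H.nonexpansive g v hg hv1 (1 - min |g b| s) (by linarith) (fun k => by
    by_cases hk : k = b
    · subst hk; rw [hvb, hgδ]; linarith
    · rw [hvk k hk]; linarith [hw2 k]) a
  rw [H.map_apply_of_levels hK hiso hr hr' hv1 hv ha hb hab, hvb] at key
  have h1 : |γ 1 b * δ| = 1 := by
    rw [abs_mul, hδ]
    rcases H.inv_unimodular hiso IsUnimodular.one b with e | e <;> rw [e] <;> simp
  have h2 := abs_sub_abs_le_abs_sub (γ 1 b * δ) (φ g a)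
  rw [abs_sub_comm, h1] at h2
  linarith

theorem min_abs_le (H : IsNonexpansiveBallHomeo φ γ) (hK : IsZeroDimensional K)
    (hiso : Dense {x : K | IsIsolatedPoint x}) (n : ℕ) :
    ∀ a b, IsIsolatedPoint a → IsIsolatedPoint b → Corresponds γ a b →
      ∀ g : C(K, ℝ), (∀ k, |g k| ≤ 1) → min |g b| (1 - (3 / 4 : ℝ) ^ n) ≤ |φ g a| := by
  induction n with
  | zero =>
    intro a b _ _ _ g _
    rw [pow_zero, sub_self]
    exact (min_le_right _ _).trans (abs_nonneg _)
  | succ n ih =>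
    intro a b ha hb hab g hg
    have h0 : (0 : ℝ) < (3 / 4) ^ n := by positivity
    have h1 : (3 / 4 : ℝ) ^ n ≤ 1 := pow_le_one₀ (by norm_num) (by norm_num)
    rw [pow_succ]
    -- With `q = (3 / 4) ^ n`, the choice `r' = 1 - 5 / 4 * q` is below `1 - q`, and `(1 + r') / 2 =
    -- 1 - 5 / 8 * q` exceeds the new level `1 - 3 / 4 * q`. If `r'` is not positive, zero serves
    -- instead.
    rcases le_total (1 - 5 / 4 * (3 / 4 : ℝ) ^ n) 0 with h | h
    · exact H.raise_level hK hiso ih (r' := 0) (Or.inr rfl) le_rfl zero_le_one (by linarith)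
        (by linarith) ha hb hab hg
    · exact H.raise_level hK hiso ih (r' := 1 - 5 / 4 * (3 / 4 : ℝ) ^ n) (Or.inl (by linarith)) h
        (by linarith) (by linarith) (by linarith) ha hb hab hg

/-- At corresponding points `φ` is a weighted composition. -/
theorem map_apply (H : IsNonexpansiveBallHomeo φ γ) (hK : IsZeroDimensional K)
    (hiso : Dense {x : K | IsIsolatedPoint x}) {a b : K} (hab : Corresponds γ a b)
    (ha : IsIsolatedPoint a) (hb : IsIsolatedPoint b) {g : C(K, ℝ)} (hg : ∀ k, |g k| ≤ 1) :
    φ g a = γ 1 b * g b := by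
  obtain ⟨h1, h2, -⟩ := H.compare_map hK hiso hab ha hb hg
  refine eq_mul_of_abs_eq (H.inv_unimodular hiso IsUnimodular.one b) h2 (le_antisymm h1 ?_)
  have lim : Tendsto (fun n : ℕ => min |g b| (1 - (3 / 4 : ℝ) ^ n)) atTop
      (𝓝 (min |g b| (1 - 0))) :=
    tendsto_const_nhds.min (tendsto_const_nhds.sub
      (tendsto_pow_atTop_nhds_zero_of_lt_one (by norm_num) (by norm_num)))
  rw [sub_zero, min_eq_left (hg b)] at lim
  exact le_of_tendsto' lim fun n => H.min_abs_le hK hiso n a b ha hb hab g hg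

theorem dist_le_dist_map (H : IsNonexpansiveBallHomeo φ γ) (hK : IsZeroDimensional K)
    (hiso : Dense {x : K | IsIsolatedPoint x}) {g h : C(K, ℝ)} (hg : ∀ k, |g k| ≤ 1)
    (hh : ∀ k, |h k| ≤ 1) : dist g h ≤ dist (φ g) (φ h) := by
  refine (ContinuousMap.dist_le dist_nonneg).2 (forall_of_isolated hiso
    (isClosed_le (g.continuous.dist h.continuous) continuous_const) fun b hb => ?_)
  obtain ⟨a, ha, hab⟩ := H.exists_corresponds_left hiso hb
  refine le_trans (le_of_eq ?_) (ContinuousMap.dist_apply_le_dist a)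
  rw [H.map_apply hK hiso hab ha hb hg, H.map_apply hK hiso hab ha hb hh, Real.dist_eq,
    Real.dist_eq, ← mul_sub, abs_mul]
  rcases H.inv_unimodular hiso IsUnimodular.one b with e | e <;> rw [e] <;> simp

end IsNonexpansiveBallHomeo

/-! ### Transfer to homeomorphisms of the closed ball -/

theorem mem_closedBall_iff_abs_le {K : Type*} [TopologicalSpace K] [CompactSpace K]
    {f : C(K, ℝ)} : f ∈ Metric.closedBall (0 : C(K, ℝ)) 1 ↔ ∀ k, |f k| ≤ 1 := by
  rw [mem_closedBall_zero_iff, ContinuousMap.norm_le _ zero_le_one]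
  rfl

open Classical in
/-- Extension by zero of a self-map of the unit ball. -/
noncomputable def ballExtension {K : Type*} [TopologicalSpace K] [CompactSpace K]
    (F : Metric.closedBall (0 : C(K, ℝ)) 1 → Metric.closedBall (0 : C(K, ℝ)) 1)
    (g : C(K, ℝ)) : C(K, ℝ) :=
  if h : g ∈ Metric.closedBall (0 : C(K, ℝ)) 1 then F ⟨g, h⟩ else 0

theorem ballExtension_coe {K : Type*} [TopologicalSpace K] [CompactSpace K]
    (F : Metric.closedBall (0 : C(K, ℝ)) 1 → Metric.closedBall (0 : C(K, ℝ)) 1)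
    (g : Metric.closedBall (0 : C(K, ℝ)) 1) : ballExtension F g = F g :=
  dif_pos g.2

theorem isNonexpansiveBallHomeo_ballExtension {K : Type*} [TopologicalSpace K] [CompactSpace K]
    (F : Metric.closedBall (0 : C(K, ℝ)) 1 ≃ₜ Metric.closedBall (0 : C(K, ℝ)) 1)
    (hF : LipschitzWith 1 F) :
    IsNonexpansiveBallHomeo (ballExtension F) (ballExtension F.symm) where
  abs_map_le g hg := by
    lift g to Metric.closedBall (0 : C(K, ℝ)) 1 using mem_closedBall_iff_abs_le.2 hg
    rw [ballExtension_coe]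
    exact mem_closedBall_iff_abs_le.1 (F g).2
  abs_inv_le g hg := by
    lift g to Metric.closedBall (0 : C(K, ℝ)) 1 using mem_closedBall_iff_abs_le.2 hg
    rw [ballExtension_coe]
    exact mem_closedBall_iff_abs_le.1 (F.symm g).2
  left_inv g hg := by
    lift g to Metric.closedBall (0 : C(K, ℝ)) 1 using mem_closedBall_iff_abs_le.2 hg
    rw [ballExtension_coe, ballExtension_coe, F.symm_apply_apply]
  right_inv g hg := by
    lift g to Metric.closedBall (0 : C(K, ℝ)) 1 using mem_closedBall_iff_abs_le.2 hg
    rw [ballExtension_coe, ballExtension_coe, F.apply_symm_apply]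
  nonexpansive g h hg hh c hc hgh k := by
    lift g to Metric.closedBall (0 : C(K, ℝ)) 1 using mem_closedBall_iff_abs_le.2 hg
    lift h to Metric.closedBall (0 : C(K, ℝ)) 1 using mem_closedBall_iff_abs_le.2 hh
    rw [ballExtension_coe, ballExtension_coe, ← Real.dist_eq]
    have h1 := hF.dist_le_mul g h
    rw [NNReal.coe_one, one_mul] at h1
    exact (ContinuousMap.dist_apply_le_dist k).trans
      (h1.trans ((ContinuousMap.dist_le hc).2 fun k => hgh k))
  continuousOn_inv := by
    have e : {f : C(K, ℝ) | ∀ k, |f k| ≤ 1} = Metric.closedBall (0 : C(K, ℝ)) 1 :=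
      Set.ext fun f => mem_closedBall_iff_abs_le.symm
    rw [e, continuousOn_iff_continuous_domRestrict]
    refine (continuous_subtype_val.comp F.symm.continuous).congr fun g => ?_
    exact (ballExtension_coe F.symm g).symm

theorem theorem1p2 {K : Type*} [TopologicalSpace K] [CompactSpace K] [T2Space K]
    (hK : IsZeroDimensional K) (hiso : Dense {x : K | IsIsolatedPoint x})
    (F : Metric.closedBall (0 : C(K, ℝ)) 1 ≃ₜ Metric.closedBall (0 : C(K, ℝ)) 1)
    (hF : LipschitzWith 1 F) : Isometry F := by
  refine Isometry.of_dist_eq fun g h => le_antisymm ?_ ?_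
  · simpa using hF.dist_le_mul g h
  · have := (isNonexpansiveBallHomeo_ballExtension F hF).dist_le_dist_map hK hiso
      (mem_closedBall_iff_abs_le.1 g.2) (mem_closedBall_iff_abs_le.1 h.2)
    rwa [ballExtension_coe, ballExtension_coe] at this
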